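/- For $\gamma,\rho,\nu,z\in\mathbb{C}$ with $\operatorname{Re}\rho>0$ let $$E^{\gamma}_{\rho,\nu}(z)=\sum_{k=0}^{\infty}\frac{(\gamma)_k\,z^k}{\Gamma(\rho k+\nu)\,k!},\qquad (\gamma)_0=1,\quad (\gamma)_k=\gamma(\gamma+1)\cdots(\gamma+k-1),$$ where $1/\Gamma=0$ at the poles of $\Gamma$. Fix $\gamma,\rho,\omega\in\mathbb{C}$ with $\operatorname{Re}\rho>0$, write $e_\nu(r)=r^{\nu-1}E^{\gamma}_{\rho,\nu}(\omega r^{\rho})$ for $r\ge 0$, and let $$\mathbf{D}^{\gamma}_{\rho,\mu,\omega,a+}x(t)=\frac{d^m}{dt^m}\int_a^t (t-u)^{m-\mu-1}E^{-\gamma}_{\rho,m-\mu}\big(\omega(t-u)^{\rho}\big)\,x(u)\,du,\qquad m=\lfloor\mu\rfloor+1,$$ be the Prabhakar derivative of order $\mu>0$. Theorem. Let $2<\mu\le 3$, $a<\xi<b$ and $\beta$ be real numbers and let $q:[a,b]\to\mathbb{R}$ be continuous. Suppose that $E^{\gamma}_{\rho,\mu-1}(\omega(b-a)^{\rho})\neq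 0$ and $e_{\mu-1}(b-a)-\beta e_{\mu}(\xi-a)\ne 0$. Let $x:[a,b]\to\mathbb{C}$ be continuous (for example, real-valued and continuous) and a solution of $$\mathbf{D}^{\gamma}_{\rho,\mu,\omega,a+}x(t)+q(t)x(t)=0\quad(a<t<b),\qquad x(a)=x'(a)=0,\quad x'(b)=\beta x(\xi),$$ meaning that the $m$-fold derivative in the definition of $\mathbf{D}^{\gamma}_{\rho,\mu,\omega,a+}x$ exists on $(a,b)$, that the equation holds there, and that the one-sided derivatives $x'(a)$, $x'(b)$ exist and the boundary conditions hold. Put $$G(t,s)=\frac{e_\mu(t-a)\,e_{\mu-1}(b-s)}{e_{\mu-1}(b-a)}-\begin{cases}e_\mu(t-s), & a\le s\le t\le b,\\ 0, & a\le t< s\le b.\end{cases}$$ Then, for every $t\in[a,b]$, the functions $s\mapsto G(t,s)q(s)x(s)$ and $s\mapsto G(\xi,s)q(s)x(s)$ are integrable on $[a,b]$ and $$x(t)=\int_a^b G(t,s)q(s)x(s)\,ds+\frac{\beta\, e_\mu(t-a)}{e_{\mu-1}(b-a)-\beta e_\mu(\xi-a)}\int_a^b G(\xi,s)q(s)x(s)\,ds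 .$$ -/

import Mathlib

open Set MeasureTheory

/-- The three-parameter (Prabhakar) Mittag-Leffler function
`E^γ_{ρ,μ}(z) = ∑ₖ (γ)ₖ zᵏ / (Γ(ρ k + μ) k!)`, used for `Re ρ > 0`.  The convention `1 / Γ = 0` at
the poles of `Γ` agrees with Mathlib's `Complex.Gamma` and division by zero. -/
noncomputable def mittagLeffler (γ ρ μ z : ℂ) : ℂ :=
  ∑' k : ℕ, (ascPochhammer ℂ k).eval γ * z ^ k /
    (Complex.Gamma (ρ * (k : ℂ) + μ) * (k.factorial : ℂ))

/-- The function `r ↦ r^(μ-1) E^γ_{ρ,μ}(ω r^ρ)`, used for real `r ≥ 0`. -/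
noncomputable def prabhakarKernel (γ ρ μ ω : ℂ) (r : ℝ) : ℂ :=
  (r : ℂ) ^ (μ - 1) * mittagLeffler γ ρ μ (ω * (r : ℂ) ^ ρ)

/-- The Prabhakar integral with base point `a`:
`t ↦ ∫ₐᵗ (t-u)^(μ-1) E^γ_{ρ,μ}(ω (t-u)^ρ) f(u) du`. -/
noncomputable def prabhakarIntegral (γ ρ μ ω : ℂ) (a : ℝ) (f : ℝ → ℂ) (t : ℝ) : ℂ :=
  ∫ u in a..t, prabhakarKernel γ ρ μ ω (t - u) * f u

/-- The number of derivatives taken in the Prabhakar derivative of order `μ`: the natural number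
`m` with `m - 1 ≤ Re μ < m`. -/
noncomputable def prabhakarIndex (μ : ℂ) : ℕ := ⌊μ.re⌋₊ + 1

/-- The Prabhakar integral of order `m - μ` with parameter `-γ`, whose `m`-th derivative is the
Prabhakar derivative of order `μ`. -/
noncomputable def prabhakarPrimitive (γ ρ μ ω : ℂ) (a : ℝ) (f : ℝ → ℂ) : ℝ → ℂ :=
  prabhakarIntegral (-γ) ρ ((prabhakarIndex μ : ℂ) - μ) ω a f

/-- The Prabhakar derivative with base point `a`:
`(d/dt)^m` applied to the Prabhakar integral of order `m - μ` with parameter `-γ`. -/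
noncomputable def prabhakarDeriv (γ ρ μ ω : ℂ) (a : ℝ) (f : ℝ → ℂ) (t : ℝ) : ℂ :=
  iteratedDeriv (prabhakarIndex μ) (prabhakarPrimitive γ ρ μ ω a f) t

/-- The Prabhakar derivative of `f` exists at every point of `(a, b)`: the primitive in its
definition is `m` times differentiable on `(a, b)`. -/
def PrabhakarDifferentiableOn (γ ρ μ ω : ℂ) (a b : ℝ) (f : ℝ → ℂ) : Prop :=
  ∀ k < prabhakarIndex μ,
    DifferentiableOn ℝ (iteratedDeriv k (prabhakarPrimitive γ ρ μ ω a f)) (Ioo a b)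

/-- `x` is a continuous solution on `[a, b]` of the nonlocal boundary value problem
`D x + q x = 0` on `(a, b)`, `x(a) = x'(a) = 0`, `x'(b) = β x(ξ)`, where `D` is the Prabhakar
derivative of order `μ` and the derivatives at the end points are one-sided. -/
structure IsNonlocalSolution (γ ρ ω : ℂ) (μ a b β ξ : ℝ) (q : ℝ → ℝ) (x : ℝ → ℂ) : Prop where
  continuousOn : ContinuousOn x (Icc a b)
  differentiableOn : PrabhakarDifferentiableOn γ ρ (μ : ℂ) ω a b x
  equation : ∀ t ∈ Ioo a b, prabhakarDeriv γ ρ (μ : ℂ) ω a x t + (q t : ℂ) * x t = 0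
  left_value : x a = 0
  left_deriv : HasDerivWithinAt x 0 (Icc a b) a
  right_deriv : HasDerivWithinAt x ((β : ℂ) * x ξ) (Icc a b) b

/-- The Green's function
`(t-a)^(μ-1) E_μ(ω(t-a)^ρ) (b-s)^(μ-2) E_(μ-1)(ω(b-s)^ρ) / ((b-a)^(μ-2) E_(μ-1)(ω(b-a)^ρ))`,
diminished by `(t-s)^(μ-1) E_μ(ω(t-s)^ρ)` when `s ≤ t`, where `E_ν = E^γ_{ρ,ν}`. -/
noncomputable def greenFunction (γ ρ ω : ℂ) (μ a b t s : ℝ) : ℂ :=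
  if s ≤ t then
    prabhakarKernel γ ρ (μ : ℂ) ω (t - a) * prabhakarKernel γ ρ ((μ : ℂ) - 1) ω (b - s) /
        prabhakarKernel γ ρ ((μ : ℂ) - 1) ω (b - a)
      - prabhakarKernel γ ρ (μ : ℂ) ω (t - s)
  else
    prabhakarKernel γ ρ (μ : ℂ) ω (t - a) * prabhakarKernel γ ρ ((μ : ℂ) - 1) ω (b - s) /
        prabhakarKernel γ ρ ((μ : ℂ) - 1) ω (b - a)

open Filter Topology
open scoped Convolution

/-! Write `*` for causal convolution. The kernels form a two-parameter semigroup, `e^γ_α * e^δ_β =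
e^(γ+δ)_(α+β)`, and `e^0_1 = 1`, so ordinary integration belongs to the family. The law is proved
termwise: the Cauchy product of two series consists of beta integrals, and Vandermonde's identity
for rising factorials sums the coefficients.

Convolving `e^(-γ)_(m-μ) * x` with `e^γ_μ` therefore gives the `m`-fold primitive of `x`. Applied to
Taylor's formula for the Prabhakar primitive, this inverts the derivative
(`eq_sum_prabhakarKernel_add_prabhakarIntegral`): `x` is a combination of kernels minus `e_μ * (q
x)`. The lowest Taylor coefficient vanishes because the primitive tends to `0` at `a`. For `μ < 3`
the kernels `e_(μ-1)` and `e_μ` remain; for `μ = 3` there is also `e_1`, excluded by `x(a) = 0`.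
Since `e_(μ-1)(r) / r` does not tend to `0`, the condition `x'(a) = 0` excludes `e_(μ-1)`, so `x = c
e_μ(t-a) - (e_μ * q x)(t)`.

Differentiation lowers the order of a kernel by one, so the condition at `b` reads `c e_(μ-1)(b-a) =
β x(ξ) + (e_(μ-1) * q x)(b)`. Inserting this `c` produces `G` and a term in `x(ξ)`; setting `t = ξ`
and solving for `x(ξ)` finishes the proof. -/

/-! ### Decay of beta integrals -/

/-- Dominated convergence with majorant `(1 - t)^(y-1)`. In the ratio test below this replaces
Stirling's formula. -/
theorem tendsto_integral_rpow_mul_one_sub_rpow {y : ℝ} (hy : 0 < y) :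
    Tendsto (fun x : ℝ => ∫ t in (0 : ℝ)..1, t ^ (x - 1) * (1 - t) ^ (y - 1)) atTop (𝓝 0) := by
  have hint : IntervalIntegrable (fun t : ℝ => (1 - t) ^ (y - 1)) volume 0 1 := by
    have h := (intervalIntegral.intervalIntegrable_rpow' (a := 0) (b := 1)
      (show -1 < y - 1 by linarith)).comp_sub_left 1
    simpa using h.symm
  have key := intervalIntegral.tendsto_integral_filter_of_dominated_convergence
    (μ := volume) (a := 0) (b := 1) (l := (atTop : Filter ℝ))
    (F := fun x t => t ^ (x - 1) * (1 - t) ^ (y - 1)) (f := fun _ => (0 : ℝ))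
    (fun t => (1 - t) ^ (y - 1)) ?_ ?_ hint ?_
  · simpa using key
  · refine Eventually.of_forall fun x => Measurable.aestronglyMeasurable ?_
    exact (measurable_id.pow_const _).mul ((measurable_const.sub measurable_id).pow_const _)
  · filter_upwards [eventually_ge_atTop 1] with x hx
    refine Eventually.of_forall fun t ht => ?_
    rw [uIoc_of_le zero_le_one] at ht
    have h1 : 0 ≤ (1 - t) ^ (y - 1) := Real.rpow_nonneg (by linarith [ht.2]) _
    rw [norm_mul, Real.norm_of_nonneg (Real.rpow_nonneg ht.1.le _), Real.norm_of_nonneg h1]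
    exact mul_le_of_le_one_left h1 (Real.rpow_le_one ht.1.le ht.2 (by linarith))
  · have hne : ∀ᵐ t : ℝ, t ≠ 1 := by simp [ae_iff]
    filter_upwards [hne] with t ht1 ht
    rw [uIoc_of_le zero_le_one] at ht
    have ht2 : t < 1 := lt_of_le_of_ne ht.2 ht1
    have h := (tendsto_rpow_atTop_of_base_lt_one t (by linarith [ht.1]) ht2).comp
      (tendsto_atTop_add_const_right atTop (-1 : ℝ) tendsto_id)
    simpa [sub_eq_add_neg] using h.mul_const ((1 - t) ^ (y - 1))

theorem norm_betaIntegral_le {u v : ℂ} :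
    ‖Complex.betaIntegral u v‖ ≤
      ∫ t in (0 : ℝ)..1, t ^ (u.re - 1) * (1 - t) ^ (v.re - 1) := by
  refine (intervalIntegral.norm_integral_le_integral_norm zero_le_one).trans_eq ?_
  rw [intervalIntegral.integral_of_le zero_le_one, intervalIntegral.integral_of_le zero_le_one,
    integral_Ioc_eq_integral_Ioo, integral_Ioc_eq_integral_Ioo]
  refine setIntegral_congr_fun measurableSet_Ioo fun t ht => ?_
  have h2 : 0 < 1 - t := by linarith [ht.2]
  simp only [norm_mul]
  rw [Complex.norm_cpow_eq_rpow_re_of_pos ht.1, show (1 : ℂ) - t = ((1 - t : ℝ) : ℂ) by push_cast; rfl,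
    Complex.norm_cpow_eq_rpow_re_of_pos h2]
  simp

/-! ### The Mittag-Leffler series -/

/-- The terms of the series of the Prabhakar function without the power of the argument. -/
noncomputable def mittagLefflerCoeff (γ ρ ν : ℂ) (k : ℕ) : ℂ :=
  (ascPochhammer ℂ k).eval γ / (Complex.Gamma (ρ * (k : ℂ) + ν) * (k.factorial : ℂ))

theorem mittagLeffler_eq_tsum (γ ρ ν z : ℂ) :
    mittagLeffler γ ρ ν z = ∑' k : ℕ, mittagLefflerCoeff γ ρ ν k * z ^ k := by
  unfold mittagLeffler mittagLefflerCoeff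
  exact tsum_congr fun k => by ring

theorem tendsto_re_mul_natCast_add {ρ : ℂ} (hρ : 0 < ρ.re) (ν : ℂ) :
    Tendsto (fun k : ℕ => (ρ * (k : ℂ) + ν).re) atTop atTop := by
  have : (fun k : ℕ => (ρ * (k : ℂ) + ν).re) = fun k : ℕ => ρ.re * (k : ℝ) + ν.re := by
    ext k; simp
  rw [this]
  exact tendsto_atTop_add_const_right _ _
    ((tendsto_natCast_atTop_atTop).const_mul_atTop hρ)

/-- Ratio test: with `w = ρ k + ν`, the quotient `Γ(w) / Γ(w + ρ) = B(w, ρ) / Γ(ρ)` tends to `0`,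
while `(γ + k) / (k + 1)` stays bounded. The finitely many `k` with `Re w ≤ 0` do not matter. -/
theorem summable_norm_mittagLefflerCoeff_mul_pow {ρ : ℂ} (hρ : 0 < ρ.re) (γ ν z : ℂ) :
    Summable fun k : ℕ => ‖mittagLefflerCoeff γ ρ ν k * z ^ k‖ := by
  set w : ℕ → ℂ := fun k => ρ * (k : ℂ) + ν with hw
  have hwt : Tendsto (fun k => (w k).re) atTop atTop := tendsto_re_mul_natCast_add hρ ν
  set B : ℝ → ℝ := fun x => ∫ t in (0 : ℝ)..1, t ^ (x - 1) * (1 - t) ^ (ρ.re - 1) with hB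
  have hΓρ : 0 < ‖Complex.Gamma ρ‖ := norm_pos_iff.2 (Complex.Gamma_ne_zero_of_re_pos hρ)
  have hratio : Tendsto (fun k : ℕ => (‖γ‖ + 1) * ‖z‖ * (B (w k).re / ‖Complex.Gamma ρ‖))
      atTop (𝓝 0) := by
    have h := ((tendsto_integral_rpow_mul_one_sub_rpow hρ).comp hwt).div_const
      ‖Complex.Gamma ρ‖ |>.const_mul ((‖γ‖ + 1) * ‖z‖)
    simpa using h
  refine summable_of_ratio_norm_eventually_le (r := 1 / 2) (by norm_num) ?_
  filter_upwards [hratio.eventually (eventually_le_nhds (show (0 : ℝ) < 1 / 2 by norm_num)),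
    hwt.eventually_gt_atTop 0] with k hk hpos
  have hnext : w (k + 1) = w k + ρ := by simp only [hw]; push_cast; ring
  have hpos' : 0 < (w (k + 1)).re := by rw [hnext, Complex.add_re]; linarith
  have hG : Complex.Gamma (w k) ≠ 0 := Complex.Gamma_ne_zero_of_re_pos hpos
  have hG' : Complex.Gamma (w (k + 1)) ≠ 0 := Complex.Gamma_ne_zero_of_re_pos hpos'
  have hGn := norm_pos_iff.2 hG
  have hGn' := norm_pos_iff.2 hG'
  have hbeta : ‖Complex.Gamma (w (k + 1))‖⁻¹ ≤
      ‖Complex.Gamma (w k)‖⁻¹ * (B (w k).re / ‖Complex.Gamma ρ‖) := by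
    have h := congrArg norm (Complex.Gamma_mul_Gamma_eq_betaIntegral hpos hρ)
    rw [← hnext, norm_mul, norm_mul] at h
    have h2 : ‖Complex.betaIntegral (w k) ρ‖ ≤ B (w k).re := norm_betaIntegral_le
    rw [inv_eq_one_div, inv_mul_eq_div, div_div, div_le_div_iff₀ hGn' (by positivity), one_mul,
      mul_comm ‖Complex.Gamma ρ‖, h, mul_comm]
    exact mul_le_mul_of_nonneg_right h2 hGn'.le
  have hcoeff : ∀ j, ‖mittagLefflerCoeff γ ρ ν j * z ^ j‖ =
      ‖(ascPochhammer ℂ j).eval γ‖ * ‖Complex.Gamma (w j)‖⁻¹ * (j.factorial : ℝ)⁻¹ * ‖z‖ ^ j := by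
    intro j
    simp only [mittagLefflerCoeff, hw, norm_mul, norm_div, norm_pow, Complex.norm_natCast]
    rw [div_eq_mul_inv, mul_inv]
    ring
  rw [norm_norm, norm_norm, hcoeff, hcoeff, ascPochhammer_succ_eval, norm_mul, pow_succ,
    Nat.factorial_succ]
  have hγk : ‖γ + (k : ℂ)‖ ≤ (‖γ‖ + 1) * ((k : ℝ) + 1) := by
    refine (norm_add_le _ _).trans ?_
    rw [Complex.norm_natCast]
    nlinarith [norm_nonneg γ, (Nat.cast_nonneg k : (0 : ℝ) ≤ k)]
  have hkpos : (0 : ℝ) < (k : ℝ) + 1 := by positivity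
  -- Read off from `hbeta`, whose left side is positive.
  have hBnn : 0 ≤ B (w k).re / ‖Complex.Gamma ρ‖ := by
    have := (inv_pos.2 hGn').trans_le hbeta
    exact (pos_of_mul_pos_right this (inv_pos.2 hGn).le).le
  push_cast
  set A := ‖(ascPochhammer ℂ k).eval γ‖
  calc A * ‖γ + (k : ℂ)‖ * ‖Complex.Gamma (w (k + 1))‖⁻¹ * (((k : ℝ) + 1) * (k.factorial : ℝ))⁻¹
        * (‖z‖ ^ k * ‖z‖)
      ≤ A * ((‖γ‖ + 1) * ((k : ℝ) + 1)) *
          (‖Complex.Gamma (w k)‖⁻¹ * (B (w k).re / ‖Complex.Gamma ρ‖))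
          * (((k : ℝ) + 1) * (k.factorial : ℝ))⁻¹ * (‖z‖ ^ k * ‖z‖) := by gcongr
    _ = ((‖γ‖ + 1) * ‖z‖ * (B (w k).re / ‖Complex.Gamma ρ‖)) *
          (A * ‖Complex.Gamma (w k)‖⁻¹ * (k.factorial : ℝ)⁻¹ * ‖z‖ ^ k) := by
        field_simp
    _ ≤ 1 / 2 * (A * ‖Complex.Gamma (w k)‖⁻¹ * (k.factorial : ℝ)⁻¹ * ‖z‖ ^ k) := by
        gcongr

theorem continuous_mittagLeffler {ρ : ℂ} (hρ : 0 < ρ.re) (γ ν : ℂ) :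
    Continuous (mittagLeffler γ ρ ν) := by
  rw [continuous_iff_continuousAt]
  intro z₀
  have hon : ContinuousOn (mittagLeffler γ ρ ν) (Metric.ball 0 (‖z₀‖ + 1)) := by
    have h := continuousOn_tsum (s := Metric.ball (0 : ℂ) (‖z₀‖ + 1))
      (f := fun (k : ℕ) z => mittagLefflerCoeff γ ρ ν k * z ^ k)
      (u := fun k => ‖mittagLefflerCoeff γ ρ ν k * ((‖z₀‖ + 1 : ℝ) : ℂ) ^ k‖)
      (fun k => by fun_prop) (summable_norm_mittagLefflerCoeff_mul_pow hρ γ ν _) ?_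
    · exact h.congr fun z _ => mittagLeffler_eq_tsum γ ρ ν z
    · intro k z hz
      rw [mem_ball_zero_iff] at hz
      have h0 : (0 : ℝ) ≤ ‖z₀‖ + 1 := by positivity
      rw [norm_mul, norm_mul, norm_pow, norm_pow, Complex.norm_real, Real.norm_of_nonneg h0]
      gcongr
  exact hon.continuousAt (Metric.isOpen_ball.mem_nhds (by simp))

theorem mittagLeffler_zero_right (γ ρ ν : ℂ) :
    mittagLeffler γ ρ ν 0 = (Complex.Gamma ν)⁻¹ := by
  rw [mittagLeffler_eq_tsum, tsum_eq_single 0]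
  · simp [mittagLefflerCoeff]
  · intro k hk; simp [hk]

theorem mittagLeffler_zero_left (ρ ν z : ℂ) :
    mittagLeffler 0 ρ ν z = (Complex.Gamma ν)⁻¹ := by
  rw [mittagLeffler_eq_tsum, tsum_eq_single 0]
  · simp [mittagLefflerCoeff]
  · intro k hk
    simp [mittagLefflerCoeff, hk]

/-- Since `(r)_k / k! = (-1)^k choose(-r, k)`, this is the Chu–Vandermonde identity. -/
theorem sum_antidiagonal_ascPochhammer_eval (γ δ : ℂ) (n : ℕ) :
    ∑ p ∈ Finset.HasAntidiagonal.antidiagonal n, (ascPochhammer ℂ p.1).eval γ / (p.1.factorial : ℂ) *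
        ((ascPochhammer ℂ p.2).eval δ / (p.2.factorial : ℂ)) =
      (ascPochhammer ℂ n).eval (γ + δ) / (n.factorial : ℂ) := by
  have key : ∀ (r : ℂ) (k : ℕ), (ascPochhammer ℂ k).eval r / (k.factorial : ℂ) =
      (-1) ^ k * Ring.choose (-r) k := by
    intro r k
    have h := Ring.factorial_nsmul_multichoose_eq_ascPochhammer r k
    rw [Polynomial.ascPochhammer_smeval_eq_eval, nsmul_eq_mul] at h
    rw [Ring.choose_neg', ← h, mul_div_cancel_left₀ _ (Nat.cast_ne_zero.2 k.factorial_ne_zero),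
      Units.smul_def, Int.negOnePow_def, zsmul_eq_mul]
    rcases Nat.even_or_odd k with hk | hk <;> simp [hk.neg_one_pow]
  simp_rw [key]
  rw [neg_add, Ring.add_choose_eq n (Commute.all _ _), Finset.mul_sum]
  refine Finset.sum_congr rfl fun p hp => ?_
  rw [← Finset.HasAntidiagonal.mem_antidiagonal.1 hp, pow_add]
  ring

/-! ### Regularity of the kernels -/

theorem ofReal_cpow_mul_natCast {r : ℝ} (hr : 0 < r) (ρ ν ω : ℂ) (k : ℕ) :
    (r : ℂ) ^ ν * (ω * (r : ℂ) ^ ρ) ^ k = ω ^ k * (r : ℂ) ^ (ρ * k + ν) := by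
  rw [Complex.cpow_add _ _ (Complex.ofReal_ne_zero.2 hr.ne'), Complex.cpow_mul_nat, mul_pow]
  ring

theorem continuous_mittagLeffler_mul_ofReal_cpow {ρ : ℂ} (hρ : 0 < ρ.re) (γ ν ω : ℂ) :
    Continuous fun r : ℝ => mittagLeffler γ ρ ν (ω * (r : ℂ) ^ ρ) :=
  (continuous_mittagLeffler hρ γ ν).comp
    (continuous_const.mul (Complex.continuous_ofReal_cpow_const hρ))

/-- Only continuity of `r^(ν-1)` at `0` is at stake. The value `ν = 1` is needed for ordinary
integration and for `μ = 3`. -/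
theorem continuous_prabhakarKernel {ρ ν : ℂ} (hρ : 0 < ρ.re) (hν : ν = 1 ∨ 1 < ν.re) (γ ω : ℂ) :
    Continuous (prabhakarKernel γ ρ ν ω) := by
  refine Continuous.mul ?_ (continuous_mittagLeffler_mul_ofReal_cpow hρ γ ν ω)
  rcases hν with rfl | hν
  · simp only [sub_self, Complex.cpow_zero]
    exact continuous_const
  · exact Complex.continuous_ofReal_cpow_const (by simpa using hν)

theorem intervalIntegrable_prabhakarKernel {ρ ν : ℂ} (hρ : 0 < ρ.re) (hν : 0 < ν.re) (γ ω : ℂ)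
    (c d : ℝ) : IntervalIntegrable (prabhakarKernel γ ρ ν ω) volume c d :=
  (intervalIntegral.intervalIntegrable_cpow' (by simpa using hν)).mul_continuousOn
    (continuous_mittagLeffler_mul_ofReal_cpow hρ γ ν ω).continuousOn

theorem prabhakarKernel_zero_right {ν : ℂ} (hν : ν ≠ 1) (γ ρ ω : ℂ) :
    prabhakarKernel γ ρ ν ω 0 = 0 := by
  simp [prabhakarKernel, Complex.zero_cpow (sub_ne_zero.2 hν)]

/-! ### Semigroup property of the kernels -/

theorem intervalIntegrable_cpow_mul_sub_cpow {u w : ℂ} (hu : 0 < u.re) (hw : 0 < w.re) {r : ℝ}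
    (hr : 0 < r) :
    IntervalIntegrable (fun v : ℝ => (v : ℂ) ^ (u - 1) * ((r : ℂ) - v) ^ (w - 1)) volume 0 r := by
  have h := ((Complex.betaIntegral_convergent hu hw).comp_mul_left (c := r⁻¹)).const_mul
    ((r : ℂ) ^ (u - 1) * (r : ℂ) ^ (w - 1))
  simp only [zero_div, one_div, inv_inv] at h
  refine h.congr ?_
  rw [uIoc_of_le hr.le]
  intro v hv
  have h0 : 0 ≤ r⁻¹ * v := mul_nonneg (inv_nonneg.2 hr.le) hv.1.le
  have h1 : 0 ≤ 1 - r⁻¹ * v := by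
    rw [sub_nonneg, inv_mul_le_iff₀ hr]; linarith [hv.2]
  have e : (1 : ℂ) - ((r⁻¹ * v : ℝ) : ℂ) = ((1 - r⁻¹ * v : ℝ) : ℂ) := by push_cast; rfl
  beta_reduce
  rw [e, mul_mul_mul_comm, ← Complex.mul_cpow_ofReal_nonneg hr.le h0,
    ← Complex.mul_cpow_ofReal_nonneg hr.le h1, ← Complex.ofReal_mul, ← Complex.ofReal_mul,
    ← Complex.ofReal_sub]
  congr 3
  · field_simp
  · field_simp

/-- The `n`-th term of the Cauchy product of the series of two Prabhakar kernels. -/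
noncomputable def prabhakarKernelCauchyTerm (γ δ ρ α β ω : ℂ) (r : ℝ) (n : ℕ) (v : ℝ) : ℂ :=
  ∑ p ∈ Finset.HasAntidiagonal.antidiagonal n,
    (mittagLefflerCoeff γ ρ α p.1 * mittagLefflerCoeff δ ρ β p.2 * ω ^ n) *
      ((v : ℂ) ^ (ρ * (p.2 : ℂ) + β - 1) * ((r : ℂ) - v) ^ (ρ * (p.1 : ℂ) + α - 1))

/-- Each summand is a scaled beta integral. Its two numerator Gamma factors cancel those in the
coefficients, and its denominator depends on `n` only, so Vandermonde's identity sums the rest. -/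
theorem integral_prabhakarKernelCauchyTerm {ρ α β : ℂ} (hρ : 0 < ρ.re) (hα : 0 < α.re)
    (hβ : 0 < β.re) (γ δ ω : ℂ) {r : ℝ} (hr : 0 < r) (n : ℕ) :
    ∫ v in (0 : ℝ)..r, prabhakarKernelCauchyTerm γ δ ρ α β ω r n v =
      (r : ℂ) ^ (α + β - 1) *
        (mittagLefflerCoeff (γ + δ) ρ (α + β) n * (ω * (r : ℂ) ^ ρ) ^ n) := by
  have hre : ∀ {ν : ℂ} (_ : 0 < ν.re) (k : ℕ), 0 < (ρ * (k : ℂ) + ν).re := by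
    intro ν hν k
    have : (ρ * (k : ℂ) + ν).re = ρ.re * (k : ℝ) + ν.re := by simp
    rw [this]; positivity
  unfold prabhakarKernelCauchyTerm
  rw [intervalIntegral.integral_finsetSum fun p _ =>
    (intervalIntegrable_cpow_mul_sub_cpow (hre hβ _) (hre hα _) hr).const_mul _]
  have hαβ : 0 < (α + β).re := by rw [Complex.add_re]; positivity
  have hG := Complex.Gamma_ne_zero_of_re_pos (hre hαβ n)
  rw [mul_left_comm, ofReal_cpow_mul_natCast hr, mittagLefflerCoeff, div_mul_eq_div_div_swap,
    ← sum_antidiagonal_ascPochhammer_eval, Finset.sum_div, Finset.sum_mul]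
  refine Finset.sum_congr rfl fun p hp => ?_
  rw [intervalIntegral.integral_const_mul, Complex.betaIntegral_scaled _ _ hr]
  have hn : (n : ℂ) = (p.1 : ℂ) + (p.2 : ℂ) := by
    rw [← Finset.HasAntidiagonal.mem_antidiagonal.1 hp]; push_cast; rfl
  have e : ρ * (p.2 : ℂ) + β + (ρ * (p.1 : ℂ) + α) = ρ * n + (α + β) := by rw [hn]; ring
  have hB := Complex.Gamma_mul_Gamma_eq_betaIntegral (hre hβ p.2) (hre hα p.1)
  rw [e] at hB ⊢
  have h1 := Complex.Gamma_ne_zero_of_re_pos (hre hα p.1)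
  have h2 := Complex.Gamma_ne_zero_of_re_pos (hre hβ p.2)
  have hB' : Complex.betaIntegral (ρ * (p.2 : ℂ) + β) (ρ * (p.1 : ℂ) + α) =
      Complex.Gamma (ρ * (p.2 : ℂ) + β) * Complex.Gamma (ρ * (p.1 : ℂ) + α) /
        Complex.Gamma (ρ * n + (α + β)) := by
    rw [hB, mul_div_cancel_left₀ _ hG]
  rw [hB', mittagLefflerCoeff, mittagLefflerCoeff, add_sub_assoc]
  have f1 : (p.1.factorial : ℂ) ≠ 0 := Nat.cast_ne_zero.2 p.1.factorial_ne_zero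
  have f2 : (p.2.factorial : ℂ) ≠ 0 := Nat.cast_ne_zero.2 p.2.factorial_ne_zero
  field_simp

theorem hasSum_prabhakarKernelCauchyTerm {ρ : ℂ} (hρ : 0 < ρ.re) (γ δ α β ω : ℂ) {r v : ℝ}
    (hv : 0 < v) (hvr : v < r) :
    HasSum (fun n => prabhakarKernelCauchyTerm γ δ ρ α β ω r n v)
      (prabhakarKernel γ ρ α ω (r - v) * prabhakarKernel δ ρ β ω v) := by
  have hs1 := summable_norm_mittagLefflerCoeff_mul_pow hρ γ α (ω * ((r - v : ℝ) : ℂ) ^ ρ)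
  have hs2 := summable_norm_mittagLefflerCoeff_mul_pow hρ δ β (ω * (v : ℂ) ^ ρ)
  have hs := (summable_norm_sum_mul_antidiagonal_of_summable_norm hs1 hs2).of_norm.hasSum
  rw [← tsum_mul_tsum_eq_tsum_sum_antidiagonal_of_summable_norm hs1 hs2,
    ← mittagLeffler_eq_tsum, ← mittagLeffler_eq_tsum] at hs
  have hs' := hs.mul_left (((r - v : ℝ) : ℂ) ^ (α - 1) * (v : ℂ) ^ (β - 1))
  have hval : prabhakarKernel γ ρ α ω (r - v) * prabhakarKernel δ ρ β ω v =
      ((r - v : ℝ) : ℂ) ^ (α - 1) * (v : ℂ) ^ (β - 1) *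
        (mittagLeffler γ ρ α (ω * ((r - v : ℝ) : ℂ) ^ ρ) *
          mittagLeffler δ ρ β (ω * (v : ℂ) ^ ρ)) := by
    unfold prabhakarKernel; ring
  rw [hval]
  rw [show (fun n => prabhakarKernelCauchyTerm γ δ ρ α β ω r n v) = _ from funext fun n => ?_]
  · exact hs'
  · rw [prabhakarKernelCauchyTerm, Finset.mul_sum]
    refine Finset.sum_congr rfl fun p hp => ?_
    have hr' : 0 < r - v := by linarith
    have e1 := ofReal_cpow_mul_natCast hr' ρ (α - 1) ω p.1
    have e2 := ofReal_cpow_mul_natCast hv ρ (β - 1) ω p.2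
    rw [add_sub_assoc, add_sub_assoc, ← Complex.ofReal_sub,
      ← Finset.HasAntidiagonal.mem_antidiagonal.1 hp, pow_add]
    linear_combination (-mittagLefflerCoeff γ ρ α p.1 * mittagLefflerCoeff δ ρ β p.2 *
      ((v : ℂ) ^ (β - 1) * (ω * (v : ℂ) ^ ρ) ^ p.2)) * e1 -
      (mittagLefflerCoeff γ ρ α p.1 * mittagLefflerCoeff δ ρ β p.2 *
      (ω ^ p.1 * ((r - v : ℝ) : ℂ) ^ (ρ * p.1 + (α - 1)))) * e2

theorem norm_ofReal_cpow_le {ρ : ℂ} (hρ : 0 ≤ ρ.re) (ν : ℂ) {r v : ℝ} (hv : 0 < v) (hvr : v ≤ r)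
    (k : ℕ) : ‖(v : ℂ) ^ (ρ * (k : ℂ) + ν - 1)‖ ≤ (r ^ ρ.re) ^ k * v ^ (ν.re - 1) := by
  rw [Complex.norm_cpow_eq_rpow_re_of_pos hv]
  have : (ρ * (k : ℂ) + ν - 1).re = ρ.re * k + (ν.re - 1) := by simp; ring
  rw [this, Real.rpow_add hv, Real.rpow_mul hv.le, Real.rpow_natCast]
  gcongr

/-- The semigroup property of the Prabhakar kernels under causal convolution. -/
theorem integral_prabhakarKernel_mul_prabhakarKernel {ρ α β : ℂ} (hρ : 0 < ρ.re) (hα : 0 < α.re)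
    (hβ : 0 < β.re) (γ δ ω : ℂ) {r : ℝ} (hr : 0 < r) :
    ∫ v in (0 : ℝ)..r, prabhakarKernel γ ρ α ω (r - v) * prabhakarKernel δ ρ β ω v =
      prabhakarKernel (γ + δ) ρ (α + β) ω r := by
  set R : ℝ := r ^ ρ.re with hR
  have hR0 : 0 ≤ R := Real.rpow_nonneg hr.le _
  -- On `(0, r)` both `|v^ρ|` and `|(r - v)^ρ|` are at most `R`, so the `n`-th Cauchy term is
  -- dominated by `U n * g v`; `U` is the Cauchy product of two absolutely convergent series at `ω
  -- R`.
  set U : ℕ → ℝ := fun n => ∑ p ∈ Finset.HasAntidiagonal.antidiagonal n,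
    ‖mittagLefflerCoeff γ ρ α p.1 * (ω * (R : ℂ)) ^ p.1‖ *
      ‖mittagLefflerCoeff δ ρ β p.2 * (ω * (R : ℂ)) ^ p.2‖ with hU
  set g : ℝ → ℝ := fun v => v ^ (β.re - 1) * (r - v) ^ (α.re - 1) with hg
  have hUs : Summable U :=
    (summable_norm_sum_mul_antidiagonal_of_summable_norm
      (summable_norm_mittagLefflerCoeff_mul_pow hρ γ α (ω * R)).norm
      (summable_norm_mittagLefflerCoeff_mul_pow hρ δ β (ω * R)).norm).of_norm
  have hne : ∀ᵐ v : ℝ, v ≠ r := by simp [ae_iff]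
  have hgint : IntervalIntegrable g volume 0 r := by
    have h := (intervalIntegrable_cpow_mul_sub_cpow (u := (β.re : ℂ)) (w := (α.re : ℂ))
      (by simpa using hβ) (by simpa using hα) hr).norm
    refine h.congr_ae ?_
    rw [EventuallyEq, ae_restrict_iff' measurableSet_uIoc, uIoc_of_le hr.le]
    filter_upwards [hne] with v hv hv'
    have h2 : 0 < r - v := by have := lt_of_le_of_ne hv'.2 hv; linarith
    rw [norm_mul, ← Complex.ofReal_sub, Complex.norm_cpow_eq_rpow_re_of_pos hv'.1,
      Complex.norm_cpow_eq_rpow_re_of_pos h2]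
    simp [hg]
  have key := intervalIntegral.hasSum_integral_of_dominated_convergence (μ := volume)
    (a := 0) (b := r) (F := prabhakarKernelCauchyTerm γ δ ρ α β ω r)
    (f := fun v => prabhakarKernel γ ρ α ω (r - v) * prabhakarKernel δ ρ β ω v)
    (fun n v => U n * g v) ?_ ?_ ?_ ?_ ?_
  · rw [← key.tsum_eq]
    simp_rw [integral_prabhakarKernelCauchyTerm hρ hα hβ γ δ ω hr]
    rw [tsum_mul_left, ← mittagLeffler_eq_tsum]
    rfl
  · intro n
    refine Measurable.aestronglyMeasurable ?_
    unfold prabhakarKernelCauchyTerm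
    exact Finset.measurable_fun_sum _ fun p _ => measurable_const.mul
      ((Complex.measurable_ofReal.pow_const _).mul
        ((measurable_const.sub Complex.measurable_ofReal).pow_const _))
  · intro n
    filter_upwards [hne] with v hv hv'
    rw [uIoc_of_le hr.le] at hv'
    have h2 : 0 < r - v := by have := lt_of_le_of_ne hv'.2 hv; linarith
    refine (norm_sum_le _ _).trans ?_
    rw [hU, Finset.sum_mul]
    refine Finset.sum_le_sum fun p hp => ?_
    have b1 := norm_ofReal_cpow_le hρ.le β hv'.1 hv'.2 p.2
    have b2 := norm_ofReal_cpow_le hρ.le α h2 (by linarith [hv'.1] : r - v ≤ r) p.1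
    rw [← Complex.ofReal_sub]
    simp only [norm_mul, norm_pow, Complex.norm_real, Real.norm_of_nonneg hR0]
    have hvβ : 0 ≤ R ^ p.2 * v ^ (β.re - 1) := mul_nonneg (pow_nonneg hR0 _)
      (Real.rpow_nonneg hv'.1.le _)
    calc _ ≤ ‖mittagLefflerCoeff γ ρ α p.1‖ * ‖mittagLefflerCoeff δ ρ β p.2‖ * ‖ω‖ ^ n *
          (R ^ p.2 * v ^ (β.re - 1) * (R ^ p.1 * (r - v) ^ (α.re - 1))) := by gcongr
      _ = _ := by
        rw [← Finset.HasAntidiagonal.mem_antidiagonal.1 hp, hg]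
        ring
  · exact Eventually.of_forall fun v _ => hUs.mul_right _
  · simp_rw [tsum_mul_right]
    exact hgint.const_mul _
  · filter_upwards [hne] with v hv hv'
    rw [uIoc_of_le hr.le] at hv'
    exact hasSum_prabhakarKernelCauchyTerm hρ γ δ α β ω hv'.1 (lt_of_le_of_ne hv'.2 hv)

/-! ### Causal convolution and Prabhakar integrals -/

/-- The convolution of two functions with supports bounded below, as an interval integral. -/
theorem convolution_eq_intervalIntegral {F H : ℝ → ℂ} {a t : ℝ} (hF : ∀ r ≤ 0, F r = 0)
    (hH : ∀ u ≤ a, H u = 0) (hat : a ≤ t) :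
    (F ⋆[ContinuousLinearMap.mul ℝ ℂ, volume] H) t = ∫ u in a..t, F (t - u) * H u := by
  rw [convolution_eq_swap, intervalIntegral.integral_of_le hat, integral_Ioc_eq_integral_Ioo,
    ← integral_indicator measurableSet_Ioo]
  congr 1 with u
  simp only [ContinuousLinearMap.mul_apply']
  by_cases hu : u ∈ Ioo a t
  · rw [indicator_of_mem hu]
  · rw [indicator_of_notMem hu]
    by_cases h1 : u ≤ a
    · rw [hH u h1, mul_zero]
    · rw [hF _ (by rw [mem_Ioo] at hu; push Not at hu h1; linarith [hu h1]), zero_mul]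

theorem convolution_eq_zero_of_le {F H : ℝ → ℂ} {a t : ℝ} (hF : ∀ r ≤ 0, F r = 0)
    (hH : ∀ u ≤ a, H u = 0) (hta : t ≤ a) :
    (F ⋆[ContinuousLinearMap.mul ℝ ℂ, volume] H) t = 0 := by
  rw [convolution_eq_swap]
  refine integral_eq_zero_of_ae (Eventually.of_forall fun u => ?_)
  simp only [ContinuousLinearMap.mul_apply', Pi.zero_apply]
  rcases le_total u a with h | h
  · rw [hH u h, mul_zero]
  · rw [hF _ (by linarith), zero_mul]

/-- Boundedness of `F₁` makes the triple convolution of norms exist at every `t`, so the identity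
holds pointwise and not merely almost everywhere. -/
theorem convolution_assoc_of_bounded {F₁ F₂ H : ℝ → ℂ} (h₁ : Integrable F₁) (h₂ : Integrable F₂)
    (hH : Integrable H) {C : ℝ} (hC : ∀ r, ‖F₁ r‖ ≤ C) (t : ℝ) :
    ((F₁ ⋆[ContinuousLinearMap.mul ℝ ℂ, volume] F₂) ⋆[ContinuousLinearMap.mul ℝ ℂ, volume] H) t =
      (F₁ ⋆[ContinuousLinearMap.mul ℝ ℂ, volume]
        (F₂ ⋆[ContinuousLinearMap.mul ℝ ℂ, volume] H)) t := by
  refine convolution_assoc _ _ _ _ (fun x y z => ?_) h₁.aestronglyMeasurable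
    h₂.aestronglyMeasurable hH.aestronglyMeasurable (h₁.ae_convolution_exists _ h₂)
    (h₂.norm.ae_convolution_exists _ hH.norm) ?_
  · simp [mul_assoc]
  · have hN := h₂.norm.integrable_convolution (ContinuousLinearMap.mul ℝ ℝ) hH.norm
    have := (hN.comp_sub_left t).bdd_mul (c := C) h₁.norm.aestronglyMeasurable
      (Eventually.of_forall fun r => by simpa using hC r)
    exact this

/-- Associativity of causal convolution. -/
theorem intervalIntegral_convolution_assoc {K₁ K₂ h : ℝ → ℂ} {a b t : ℝ} (h₁ : Continuous K₁)
    (h₂ : ∀ c d, IntervalIntegrable K₂ volume c d) (hh : IntervalIntegrable h volume a b)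
    (hat : a ≤ t) (htb : t ≤ b) :
    ∫ u in a..t, K₁ (t - u) * (∫ s in a..u, K₂ (u - s) * h s) =
      ∫ u in a..t, (∫ v in (0 : ℝ)..(t - u), K₁ (t - u - v) * K₂ v) * h u := by
  have hab : a ≤ b := hat.trans htb
  set L := b - a with hL
  have hL0 : 0 ≤ L := by linarith
  -- Truncation gives integrability on the line; for `t` in `[a, b]` only arguments in the retained
  -- ranges enter, up to null sets.
  set F₁ := (Ioc 0 L).indicator K₁ with hF₁
  set F₂ := (Ioc 0 L).indicator K₂ with hF₂
  set H := (Ioc a b).indicator h with hHdef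
  have c₁ : ∀ r ≤ 0, F₁ r = 0 := fun r hr => indicator_of_notMem (fun h => by linarith [h.1]) _
  have c₂ : ∀ r ≤ 0, F₂ r = 0 := fun r hr => indicator_of_notMem (fun h => by linarith [h.1]) _
  have cH : ∀ u ≤ a, H u = 0 := fun r hr => indicator_of_notMem (fun h => by linarith [h.1]) _
  have i₁ : Integrable F₁ := (integrable_indicator_iff measurableSet_Ioc).2
    ((h₁.intervalIntegrable 0 L).1)
  have i₂ : Integrable F₂ := (integrable_indicator_iff measurableSet_Ioc).2 (h₂ 0 L).1
  have iH : Integrable H := (integrable_indicator_iff measurableSet_Ioc).2 hh.1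
  obtain ⟨C, hC⟩ := isCompact_Icc.exists_bound_of_continuousOn (h₁.continuousOn (s := Icc 0 L))
  have hC' : ∀ r, ‖F₁ r‖ ≤ max C 0 := by
    intro r
    by_cases hr : r ∈ Ioc 0 L
    · rw [hF₁, indicator_of_mem hr]
      exact (hC r (Ioc_subset_Icc_self hr)).trans (le_max_left _ _)
    · rw [hF₁, indicator_of_notMem hr]; simp
  have key := convolution_assoc_of_bounded i₁ i₂ iH hC' t
  have e₁ : ∀ {u : ℝ}, a ≤ u → u ≤ b → (F₂ ⋆[ContinuousLinearMap.mul ℝ ℂ, volume] H) u =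
      ∫ s in a..u, K₂ (u - s) * h s := by
    intro u hau hub
    rw [convolution_eq_intervalIntegral c₂ cH hau]
    rw [intervalIntegral.integral_of_le hau, intervalIntegral.integral_of_le hau,
      integral_Ioc_eq_integral_Ioo, integral_Ioc_eq_integral_Ioo]
    refine setIntegral_congr_fun measurableSet_Ioo fun s hs => ?_
    rw [hF₂, hHdef, indicator_of_mem (show s ∈ Ioc a b from ⟨hs.1, by linarith [hs.2]⟩),
      indicator_of_mem (show u - s ∈ Ioc 0 L from ⟨by linarith [hs.2], by linarith [hs.1]⟩)]
  have e₂ : ∀ {r : ℝ}, 0 ≤ r → r ≤ L → (F₁ ⋆[ContinuousLinearMap.mul ℝ ℂ, volume] F₂) r =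
      ∫ v in (0 : ℝ)..r, K₁ (r - v) * K₂ v := by
    intro r hr hrL
    rw [convolution_eq_intervalIntegral c₁ c₂ hr]
    rw [intervalIntegral.integral_of_le hr, intervalIntegral.integral_of_le hr,
      integral_Ioc_eq_integral_Ioo, integral_Ioc_eq_integral_Ioo]
    refine setIntegral_congr_fun measurableSet_Ioo fun s hs => ?_
    rw [hF₁, hF₂, indicator_of_mem (show s ∈ Ioc 0 L from ⟨hs.1, by linarith [hs.2]⟩),
      indicator_of_mem (show r - s ∈ Ioc 0 L from ⟨by linarith [hs.2], by linarith [hs.1]⟩)]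
  rw [convolution_eq_intervalIntegral (fun r hr => convolution_eq_zero_of_le c₁ c₂ hr) cH hat,
    convolution_eq_intervalIntegral c₁ (fun r hr => convolution_eq_zero_of_le c₂ cH hr) hat] at key
  rw [intervalIntegral.integral_of_le hat, intervalIntegral.integral_of_le hat,
    integral_Ioc_eq_integral_Ioo, integral_Ioc_eq_integral_Ioo] at key ⊢
  refine (setIntegral_congr_fun measurableSet_Ioo fun u hu => ?_).trans
    (key.symm.trans (setIntegral_congr_fun measurableSet_Ioo fun u hu => ?_))
  · rw [e₁ hu.1.le (by linarith [hu.2]), hF₁,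
      indicator_of_mem (show t - u ∈ Ioc 0 L from ⟨by linarith [hu.2], by linarith [hu.1]⟩)]
  · rw [e₂ (by linarith [hu.2]) (by linarith [hu.1]), hHdef,
      indicator_of_mem (show u ∈ Ioc a b from ⟨hu.1, by linarith [hu.2]⟩)]

/-- The semigroup property of the Prabhakar integrals. -/
theorem prabhakarIntegral_prabhakarIntegral {ρ α β : ℂ} (hρ : 0 < ρ.re) (hα : α = 1 ∨ 1 < α.re)
    (hβ : 0 < β.re) (γ δ ω : ℂ) {a b : ℝ} {h : ℝ → ℂ} (hh : IntervalIntegrable h volume a b)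
    {t : ℝ} (ht : t ∈ Icc a b) :
    prabhakarIntegral γ ρ α ω a (prabhakarIntegral δ ρ β ω a h) t =
      prabhakarIntegral (γ + δ) ρ (α + β) ω a h t := by
  have hα' : 0 < α.re := by
    rcases hα with rfl | hα
    · simp
    · linarith
  unfold prabhakarIntegral
  rw [intervalIntegral_convolution_assoc (continuous_prabhakarKernel hρ hα γ ω)
    (intervalIntegrable_prabhakarKernel hρ hβ δ ω) hh ht.1 ht.2,
    intervalIntegral.integral_of_le ht.1, intervalIntegral.integral_of_le ht.1,
    integral_Ioc_eq_integral_Ioo, integral_Ioc_eq_integral_Ioo]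
  refine setIntegral_congr_fun measurableSet_Ioo fun u hu => ?_
  rw [integral_prabhakarKernel_mul_prabhakarKernel hρ hα' hβ γ δ ω (by linarith [hu.2])]

theorem prabhakarIntegral_congr {γ ρ ν ω : ℂ} {a b : ℝ} {f g : ℝ → ℂ} (hfg : EqOn f g (Ioo a b))
    {t : ℝ} (ht : t ∈ Icc a b) :
    prabhakarIntegral γ ρ ν ω a f t = prabhakarIntegral γ ρ ν ω a g t := by
  unfold prabhakarIntegral
  rw [intervalIntegral.integral_of_le ht.1, intervalIntegral.integral_of_le ht.1,
    integral_Ioc_eq_integral_Ioo, integral_Ioc_eq_integral_Ioo]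
  refine setIntegral_congr_fun measurableSet_Ioo fun u hu => ?_
  rw [hfg ⟨hu.1, hu.2.trans_le ht.2⟩]

theorem continuous_prabhakarIntegral {ρ ν : ℂ} (hρ : 0 < ρ.re) (hν : ν = 1 ∨ 1 < ν.re) (γ ω : ℂ)
    (a : ℝ) {h : ℝ → ℂ} (hh : Continuous h) : Continuous (prabhakarIntegral γ ρ ν ω a h) := by
  have hK := continuous_prabhakarKernel hρ hν γ ω
  unfold prabhakarIntegral
  exact intervalIntegral.continuous_parametric_intervalIntegral_of_continuous
    (by fun_prop) continuous_id

/-! ### Iterated primitives and Taylor's formula -/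

/-- The primitive of `f` that vanishes at `a`. -/
noncomputable def primitiveFrom (a : ℝ) (f : ℝ → ℂ) (t : ℝ) : ℂ := ∫ u in a..t, f u

theorem prabhakarKernel_zero_one (ρ ω : ℂ) (r : ℝ) : prabhakarKernel 0 ρ 1 ω r = 1 := by
  simp [prabhakarKernel, mittagLeffler_zero_left]

theorem prabhakarIntegral_zero_one (ρ ω : ℂ) (a : ℝ) :
    prabhakarIntegral 0 ρ 1 ω a = primitiveFrom a := by
  ext f t
  simp [prabhakarIntegral, prabhakarKernel_zero_one, primitiveFrom]

theorem hasDerivAt_primitiveFrom {f : ℝ → ℂ} (hf : Continuous f) (a t : ℝ) :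
    HasDerivAt (primitiveFrom a f) (f t) t :=
  intervalIntegral.integral_hasDerivAt_right (hf.intervalIntegrable _ _)
    (hf.stronglyMeasurableAtFilter _ _) hf.continuousAt

theorem continuous_primitiveFrom {f : ℝ → ℂ} (hf : Continuous f) (a : ℝ) :
    Continuous (primitiveFrom a f) :=
  continuous_iff_continuousAt.2 fun t => (hasDerivAt_primitiveFrom hf a t).continuousAt

theorem continuous_iterate_primitiveFrom {f : ℝ → ℂ} (hf : Continuous f) (a : ℝ) (n : ℕ) :
    Continuous ((primitiveFrom a)^[n] f) := by
  induction n with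
  | zero => exact hf
  | succ n ih =>
    rw [Function.iterate_succ_apply']
    exact continuous_primitiveFrom ih a

theorem iterate_primitiveFrom_succ_self (a : ℝ) (f : ℝ → ℂ) (n : ℕ) :
    (primitiveFrom a)^[n + 1] f a = 0 := by
  rw [Function.iterate_succ_apply']
  simp [primitiveFrom]

theorem primitiveFrom_congr {a b : ℝ} {f g : ℝ → ℂ} (hfg : EqOn f g (Icc a b)) :
    EqOn (primitiveFrom a f) (primitiveFrom a g) (Icc a b) := by
  intro t ht
  refine intervalIntegral.integral_congr fun u hu => hfg ?_
  rw [uIcc_of_le ht.1] at hu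
  exact ⟨hu.1, hu.2.trans ht.2⟩

/-- Differentiate on the open interval, then pass to the closure by continuity. -/
theorem eqOn_of_iterate_primitiveFrom_eqOn {a b : ℝ} (hab : a < b) {f g : ℝ → ℂ}
    (hf : Continuous f) (hg : Continuous g) {n : ℕ}
    (h : EqOn ((primitiveFrom a)^[n] f) ((primitiveFrom a)^[n] g) (Icc a b)) :
    EqOn f g (Icc a b) := by
  induction n with
  | zero => exact h
  | succ n ih =>
    apply ih
    have hfc := continuous_iterate_primitiveFrom hf a n
    have hgc := continuous_iterate_primitiveFrom hg a n
    rw [← closure_Ioo hab.ne]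
    refine EqOn.closure (fun t ht => ?_) hfc hgc
    rw [Function.iterate_succ_apply', Function.iterate_succ_apply'] at h
    have hev : primitiveFrom a ((primitiveFrom a)^[n] f) =ᶠ[𝓝 t]
        primitiveFrom a ((primitiveFrom a)^[n] g) := by
      filter_upwards [Ioo_mem_nhds ht.1 ht.2] with s hs
      exact h (Ioo_subset_Icc_self hs)
    exact (hasDerivAt_primitiveFrom hfc a t).unique
      ((hasDerivAt_primitiveFrom hgc a t).congr_of_eventuallyEq hev)

/-- Taylor's formula with iterated primitives of `1` in place of the monomials `(t-a)^k / k!`.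
Nothing is assumed about `f` at the end points. -/
theorem eq_sum_iterate_primitiveFrom {a b : ℝ} {h : ℝ → ℂ} (hh : Continuous h) {m : ℕ}
    {f : ℝ → ℂ} (hd : ∀ k < m, DifferentiableOn ℝ (iteratedDeriv k f) (Ioo a b))
    (hm : ∀ t ∈ Ioo a b, iteratedDeriv m f t = h t) :
    ∃ c : ℕ → ℂ, ∀ t ∈ Ioo a b,
      f t = ∑ k ∈ Finset.range m, c k * (primitiveFrom a)^[k] (fun _ => 1) t +
        (primitiveFrom a)^[m] h t := by
  induction m generalizing f with
  | zero =>
    refine ⟨0, fun t ht => ?_⟩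
    simpa using hm t ht
  | succ m ih =>
    obtain ⟨c, hc⟩ := ih (f := deriv f)
      (fun k hk => by rw [← iteratedDeriv_succ']; exact hd _ (by omega))
      (fun t ht => by rw [← iteratedDeriv_succ']; exact hm t ht)
    set g : ℝ → ℂ := fun t => ∑ k ∈ Finset.range m,
      c k * (primitiveFrom a)^[k + 1] (fun _ => 1) t + (primitiveFrom a)^[m + 1] h t with hg
    have hgd : ∀ t, HasDerivAt g (∑ k ∈ Finset.range m,
        c k * (primitiveFrom a)^[k] (fun _ => 1) t + (primitiveFrom a)^[m] h t) t := by
      intro t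
      simp only [hg, Function.iterate_succ_apply']
      exact (HasDerivAt.fun_sum fun k _ => (hasDerivAt_primitiveFrom
        (continuous_iterate_primitiveFrom continuous_const a k) a t).const_mul (c k)).add
        (hasDerivAt_primitiveFrom (continuous_iterate_primitiveFrom hh a m) a t)
    have hfd : ∀ t ∈ Ioo a b, HasDerivAt f (deriv f t) t := by
      intro t ht
      have := hd 0 (by omega)
      rw [iteratedDeriv_zero] at this
      exact (this.differentiableAt (isOpen_Ioo.mem_nhds ht)).hasDerivAt
    have hfg : ∀ t ∈ Ioo a b, HasDerivAt (f - g) 0 t := by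
      intro t ht
      have := (hfd t ht).sub (hgd t)
      rwa [hc t ht, sub_self] at this
    obtain ⟨C, hC⟩ : ∃ C, ∀ t ∈ Ioo a b, (f - g) t = C :=
      isOpen_Ioo.exists_is_const_of_deriv_eq_zero isPreconnected_Ioo
        (fun t ht => (hfg t ht).differentiableAt.differentiableWithinAt)
        (fun t ht => (hfg t ht).deriv)
    -- Integration shifts the coefficients of `deriv f` up by one; the new constant takes index `0`.
    refine ⟨fun k => k.casesOn C c, fun t ht => ?_⟩
    rw [Finset.sum_range_succ']
    have := hC t ht
    simp only [Pi.sub_apply, hg] at this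
    simp only [Function.iterate_zero, id, mul_one]
    linear_combination this

/-! ### Calculus of Prabhakar integrals -/

theorem prabhakarIntegral_add {ρ ν : ℂ} (hρ : 0 < ρ.re) (hν : 0 < ν.re) (γ ω : ℂ) (a t : ℝ)
    {f g : ℝ → ℂ} (hf : Continuous f) (hg : Continuous g) :
    prabhakarIntegral γ ρ ν ω a (fun u => f u + g u) t =
      prabhakarIntegral γ ρ ν ω a f t + prabhakarIntegral γ ρ ν ω a g t := by
  have hK : IntervalIntegrable (fun u => prabhakarKernel γ ρ ν ω (t - u)) volume a t := by
    have := (intervalIntegrable_prabhakarKernel hρ hν γ ω (t - a) 0).comp_sub_left t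
    simpa using this
  unfold prabhakarIntegral
  rw [← intervalIntegral.integral_add (hK.mul_continuousOn hf.continuousOn)
    (hK.mul_continuousOn hg.continuousOn)]
  simp only [mul_add]

theorem prabhakarIntegral_const_mul (γ ρ ν ω : ℂ) (a t : ℝ) (c : ℂ) (f : ℝ → ℂ) :
    prabhakarIntegral γ ρ ν ω a (fun u => c * f u) t = c * prabhakarIntegral γ ρ ν ω a f t := by
  unfold prabhakarIntegral
  rw [← intervalIntegral.integral_const_mul]
  simp only [mul_left_comm]

theorem prabhakarIntegral_sum {ρ ν : ℂ} (hρ : 0 < ρ.re) (hν : 0 < ν.re) (γ ω : ℂ) (a t : ℝ)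
    (n : ℕ) (c : ℕ → ℂ) {f : ℕ → ℝ → ℂ} (hf : ∀ k < n, Continuous (f k)) :
    prabhakarIntegral γ ρ ν ω a (fun u => ∑ k ∈ Finset.range n, c k * f k u) t =
      ∑ k ∈ Finset.range n, c k * prabhakarIntegral γ ρ ν ω a (f k) t := by
  induction n with
  | zero => simp [prabhakarIntegral]
  | succ n ih =>
    simp only [Finset.sum_range_succ]
    have h1 : Continuous fun u => ∑ k ∈ Finset.range n, c k * f k u :=
      continuous_finsetSum _ fun k hk =>
        continuous_const.mul (hf k (by have := Finset.mem_range.1 hk; omega))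
    have h2 : Continuous fun u => c n * f n u := continuous_const.mul (hf n (by omega))
    rw [prabhakarIntegral_add hρ hν γ ω a t h1 h2, ih (fun k hk => hf k (by omega)),
      prabhakarIntegral_const_mul]

/-- A primitive is the Prabhakar integral with parameter `0` and order `1`, and parameters and
orders add commutatively. -/
theorem prabhakarIntegral_iterate_primitiveFrom {ρ ν : ℂ} (hρ : 0 < ρ.re)
    (hν : ν = 1 ∨ 1 < ν.re) (γ ω : ℂ) (a b : ℝ) {g : ℝ → ℂ} (hg : Continuous g) (n : ℕ) :
    EqOn (prabhakarIntegral γ ρ ν ω a ((primitiveFrom a)^[n] g))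
      ((primitiveFrom a)^[n] (prabhakarIntegral γ ρ ν ω a g)) (Icc a b) := by
  have hν' : 0 < ν.re := by
    rcases hν with rfl | hν
    · simp
    · linarith
  induction n with
  | zero => exact fun t _ => rfl
  | succ n ih =>
    intro t ht
    have hc := continuous_iterate_primitiveFrom hg a n
    rw [Function.iterate_succ_apply', Function.iterate_succ_apply', ← primitiveFrom_congr ih ht]
    generalize (primitiveFrom a)^[n] g = g' at hc
    rw [← prabhakarIntegral_zero_one ρ ω a,
      prabhakarIntegral_prabhakarIntegral hρ hν (by simp) _ _ _ (hc.intervalIntegrable a b) ht,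
      prabhakarIntegral_prabhakarIntegral hρ (Or.inl rfl) hν' _ _ _ (hc.intervalIntegrable a b) ht,
      add_comm γ, add_comm ν]

theorem iterate_primitiveFrom_eq_prabhakarIntegral {ρ : ℂ} (hρ : 0 < ρ.re) (ω : ℂ) (a b : ℝ)
    {g : ℝ → ℂ} (hg : Continuous g) (n : ℕ) :
    EqOn ((primitiveFrom a)^[n + 1] g) (prabhakarIntegral 0 ρ ((n : ℂ) + 1) ω a g) (Icc a b) := by
  induction n with
  | zero =>
    intro t ht
    simp [prabhakarIntegral_zero_one]
  | succ n ih =>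
    intro t ht
    rw [Function.iterate_succ_apply', primitiveFrom_congr ih ht,
      ← prabhakarIntegral_zero_one ρ ω a, prabhakarIntegral_prabhakarIntegral hρ (Or.inl rfl) (by
        simp; positivity) _ _ _ (hg.intervalIntegrable a b) ht, add_zero, add_comm 1]
    push_cast
    rfl

theorem integral_prabhakarKernel {ρ ν : ℂ} (hρ : 0 < ρ.re) (hν : 0 < ν.re) (γ ω : ℂ) {r : ℝ}
    (hr : 0 ≤ r) :
    ∫ v in (0 : ℝ)..r, prabhakarKernel γ ρ ν ω v = prabhakarKernel γ ρ (ν + 1) ω r := by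
  rcases hr.eq_or_lt with rfl | hr
  · rw [prabhakarKernel_zero_right, intervalIntegral.integral_same]
    intro h
    rw [add_eq_right.1 h] at hν
    simp at hν
  · have h := integral_prabhakarKernel_mul_prabhakarKernel (α := 1) hρ (by simp) hν 0 γ ω hr
    simpa [prabhakarKernel_zero_one, add_comm] using h

theorem primitiveFrom_prabhakarKernel {ρ ν : ℂ} (hρ : 0 < ρ.re) (hν : 0 < ν.re) (γ ω : ℂ)
    (a b : ℝ) : EqOn (primitiveFrom a fun t => prabhakarKernel γ ρ ν ω (t - a))
      (fun t => prabhakarKernel γ ρ (ν + 1) ω (t - a)) (Icc a b) := by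
  intro t ht
  have h := intervalIntegral.integral_comp_sub_right (prabhakarKernel γ ρ ν ω) a (a := a) (b := t)
  simp only [primitiveFrom]
  rw [h, sub_self, integral_prabhakarKernel hρ hν γ ω (by linarith [ht.1])]

theorem iterate_primitiveFrom_prabhakarKernel {ρ ν : ℂ} (hρ : 0 < ρ.re) (hν : 0 < ν.re) (γ ω : ℂ)
    (a b : ℝ) (n : ℕ) :
    EqOn ((primitiveFrom a)^[n] fun t => prabhakarKernel γ ρ ν ω (t - a))
      (fun t => prabhakarKernel γ ρ (ν + n) ω (t - a)) (Icc a b) := by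
  induction n with
  | zero => intro t _; simp
  | succ n ih =>
    intro t ht
    rw [Function.iterate_succ_apply', primitiveFrom_congr ih ht,
      primitiveFrom_prabhakarKernel hρ (by simp; positivity) γ ω a b ht]
    push_cast
    rw [add_assoc]

theorem prabhakarIntegral_one {ρ ν : ℂ} (hρ : 0 < ρ.re) (hν : 0 < ν.re) (γ ω : ℂ) {a t : ℝ}
    (hat : a ≤ t) :
    prabhakarIntegral γ ρ ν ω a (fun _ => 1) t = prabhakarKernel γ ρ (ν + 1) ω (t - a) := by
  have h := intervalIntegral.integral_comp_sub_left (prabhakarKernel γ ρ ν ω) t (a := a) (b := t)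
  simp only [prabhakarIntegral, mul_one]
  rw [h, sub_self, integral_prabhakarKernel hρ hν γ ω (by linarith)]

/-- Near `a` the function is bounded and the kernel integrable. This removes the constant term in
Taylor's formula. -/
theorem tendsto_prabhakarIntegral {ρ ν : ℂ} (hρ : 0 < ρ.re) (hν : 0 < ν.re) (γ ω : ℂ) (a : ℝ)
    {f : ℝ → ℂ} (hf : Continuous f) :
    Tendsto (prabhakarIntegral γ ρ ν ω a f) (𝓝[>] a) (𝓝 0) := by
  obtain ⟨C, hC⟩ := isCompact_Icc.exists_bound_of_continuousOn
    (hf.continuousOn (s := Icc a (a + 1)))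
  have hKn : ∀ c d, IntervalIntegrable (fun v => ‖prabhakarKernel γ ρ ν ω v‖) volume c d :=
    fun c d => (intervalIntegrable_prabhakarKernel hρ hν γ ω c d).norm
  have hlim : Tendsto (fun t => C * ∫ v in (0 : ℝ)..(t - a), ‖prabhakarKernel γ ρ ν ω v‖)
      (𝓝[>] a) (𝓝 0) := by
    have hcont : Continuous fun t => C * ∫ v in (0 : ℝ)..(t - a), ‖prabhakarKernel γ ρ ν ω v‖ :=
      continuous_const.mul ((intervalIntegral.continuous_primitive hKn 0).comp
        (continuous_id.sub continuous_const))
    have := hcont.tendsto a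
    simp only [sub_self, intervalIntegral.integral_same, mul_zero] at this
    exact this.mono_left nhdsWithin_le_nhds
  refine squeeze_zero_norm' ?_ hlim
  filter_upwards [Ioo_mem_nhdsGT (show a < a + 1 by linarith)] with t ht
  have hsub := intervalIntegral.integral_comp_sub_left
    (fun v => C * ‖prabhakarKernel γ ρ ν ω v‖) t (a := a) (b := t)
  rw [sub_self] at hsub
  rw [← intervalIntegral.integral_const_mul, ← hsub]
  refine intervalIntegral.norm_integral_le_of_norm_le ht.1.le ?_ ?_
  · refine Eventually.of_forall fun u hu => ?_
    rw [norm_mul, mul_comm]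
    gcongr
    exact hC u ⟨hu.1.le, by linarith [hu.2, ht.2]⟩
  · have := ((hKn (t - a) 0).comp_sub_left t).const_mul C
    simpa using this

/-! ### Inversion of the Prabhakar derivative -/

/-- A continuous function with a continuous Prabhakar derivative is, up to a combination of
Prabhakar kernels, the Prabhakar integral of its derivative. -/
theorem eq_sum_prabhakarKernel_add_prabhakarIntegral {γ ρ ω : ℂ} (hρ : 0 < ρ.re) {μ a b : ℝ}
    (hμ : 1 < μ) (hab : a < b) {x y h : ℝ → ℂ} (hy : Continuous y) (hxy : EqOn x y (Icc a b))
    (hh : Continuous h) (hd : PrabhakarDifferentiableOn γ ρ (μ : ℂ) ω a b x)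
    (hm : ∀ t ∈ Ioo a b, prabhakarDeriv γ ρ (μ : ℂ) ω a x t = h t) :
    ∃ c : ℕ → ℂ, ∀ t ∈ Icc a b,
      x t = ∑ k ∈ Finset.range ⌊μ⌋₊,
          c k * prabhakarKernel γ ρ ((μ : ℂ) - (⌊μ⌋₊ : ℂ) + 1 + (k : ℂ)) ω (t - a) +
        prabhakarIntegral γ ρ (μ : ℂ) ω a h t := by
  set n := ⌊μ⌋₊ with hn
  have hidx : prabhakarIndex (μ : ℂ) = n + 1 := by simp [prabhakarIndex, hn]
  have hnle : (n : ℝ) ≤ μ := Nat.floor_le (by linarith)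
  have hltn : μ < n + 1 := Nat.lt_floor_add_one μ
  have hμν : (μ : ℂ) = 1 ∨ 1 < (μ : ℂ).re := Or.inr (by simpa using hμ)
  have hμ0 : 0 < (μ : ℂ).re := by simp; linarith
  set α : ℂ := ((n : ℂ) + 1) - μ with hα
  have hα0 : 0 < α.re := by simp [hα]; linarith
  have hPx : prabhakarPrimitive γ ρ (μ : ℂ) ω a x = prabhakarIntegral (-γ) ρ α ω a x := by
    rw [prabhakarPrimitive, hidx]; push_cast; rfl
  obtain ⟨c, hc⟩ := eq_sum_iterate_primitiveFrom hh hd (fun t ht => by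
    exact hm t ht)
  rw [hidx, hPx] at hc
  have hPy : EqOn (prabhakarIntegral (-γ) ρ α ω a x) (prabhakarIntegral (-γ) ρ α ω a y)
      (Icc a b) := fun t ht => prabhakarIntegral_congr (hxy.mono Ioo_subset_Icc_self) ht
  have h1c : ∀ k, Continuous ((primitiveFrom a)^[k] fun _ => (1 : ℂ)) :=
    fun k => continuous_iterate_primitiveFrom continuous_const a k
  have hhc := continuous_iterate_primitiveFrom hh a (n + 1)
  -- Every other term vanishes at `a`, so `c 0` is the limit of the primitive there.
  have hc0 : c 0 = 0 := by
    have hcont : Continuous fun t => ∑ k ∈ Finset.range (n + 1),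
        c k * (primitiveFrom a)^[k] (fun _ => 1) t + (primitiveFrom a)^[n + 1] h t :=
      (continuous_finsetSum _ fun k _ => continuous_const.mul (h1c k)).add hhc
    have h1 := (hcont.tendsto a).mono_left (nhdsWithin_le_nhds (s := Ioi a))
    rw [Finset.sum_range_succ', iterate_primitiveFrom_succ_self, Finset.sum_eq_zero
      (fun k _ => by rw [iterate_primitiveFrom_succ_self, mul_zero])] at h1
    simp only [Function.iterate_zero, id, mul_one, zero_add, add_zero] at h1
    refine tendsto_nhds_unique (h1.congr' ?_) (tendsto_prabhakarIntegral hρ hα0 (-γ) ω a hy)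
    filter_upwards [Ioo_mem_nhdsGT hab] with t ht
    rw [← hPy (Ioo_subset_Icc_self ht), hc t ht]
  refine ⟨fun k => c (k + 1), ?_⟩
  -- Order `1` occurs exactly when `μ` is an integer and `k = 0`.
  have hν : ∀ k : ℕ, ((μ : ℂ) - (n : ℂ) + 1 + (k : ℂ)) = 1 ∨
      1 < ((μ : ℂ) - (n : ℂ) + 1 + (k : ℂ)).re := by
    intro k
    have hre : ((μ : ℂ) - (n : ℂ) + 1 + (k : ℂ)) = ((μ - n + 1 + k : ℝ) : ℂ) := by push_cast; rfl
    rw [hre, Complex.ofReal_re]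
    rcases (show 1 ≤ μ - n + 1 + k by linarith [(Nat.cast_nonneg k : (0 : ℝ) ≤ k)]).eq_or_lt
      with h | h
    · left; rw [← h]; simp
    · exact Or.inr h
  have hν0 : ∀ k : ℕ, 0 < ((μ : ℂ) - (n : ℂ) + 1 + (k : ℂ)).re := fun k => by
    rcases hν k with h | h
    · rw [h]; simp
    · linarith
  have hKc : ∀ k : ℕ, Continuous fun t : ℝ =>
      prabhakarKernel γ ρ ((μ : ℂ) - (n : ℂ) + 1 + (k : ℂ)) ω (t - a) := fun k =>
    (continuous_prabhakarKernel hρ (hν k) γ ω).comp (continuous_id.sub continuous_const)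
  have hsumc : Continuous fun t : ℝ => ∑ k ∈ Finset.range n,
      c (k + 1) * prabhakarKernel γ ρ ((μ : ℂ) - (n : ℂ) + 1 + (k : ℂ)) ω (t - a) :=
    continuous_finsetSum _ fun k _ => continuous_const.mul (hKc k)
  have hIc := continuous_prabhakarIntegral hρ hμν γ ω a hh
  suffices H : EqOn y (fun t => ∑ k ∈ Finset.range n,
      c (k + 1) * prabhakarKernel γ ρ ((μ : ℂ) - (n : ℂ) + 1 + (k : ℂ)) ω (t - a) +
        prabhakarIntegral γ ρ (μ : ℂ) ω a h t) (Icc a b) from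
    fun t ht => (hxy ht).trans (H ht)
  -- It suffices to compare `(n + 1)`-fold primitives; for `y` this is the integral of order `μ`
  -- applied to the one of order `α = n + 1 - μ`, the parameters `γ` and `-γ` cancelling.
  refine eqOn_of_iterate_primitiveFrom_eqOn hab hy (hsumc.add hIc) (n := n + 1) fun t ht => ?_
  have hn1 : 0 < ((n : ℂ) + 1).re := by simp; positivity
  have lhs : (primitiveFrom a)^[n + 1] y t =
      prabhakarIntegral γ ρ (μ : ℂ) ω a (prabhakarIntegral (-γ) ρ α ω a y) t := by
    rw [iterate_primitiveFrom_eq_prabhakarIntegral hρ ω a b hy n ht,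
      prabhakarIntegral_prabhakarIntegral hρ hμν hα0 _ _ _ (hy.intervalIntegrable a b) ht,
      add_neg_cancel, hα, add_sub_cancel]
  have hP : EqOn (prabhakarIntegral (-γ) ρ α ω a y) (fun t => ∑ k ∈ Finset.range n,
      c (k + 1) * (primitiveFrom a)^[k + 1] (fun _ => 1) t + (primitiveFrom a)^[n + 1] h t)
      (Ioo a b) := by
    intro s hs
    rw [← hPy (Ioo_subset_Icc_self hs), hc s hs, Finset.sum_range_succ', hc0]
    simp
  have h1s : Continuous fun t => ∑ k ∈ Finset.range n,
      c (k + 1) * (primitiveFrom a)^[k + 1] (fun _ => 1) t :=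
    continuous_finsetSum _ fun k _ => continuous_const.mul (h1c (k + 1))
  have hsI : Continuous fun t : ℝ => ∑ k ∈ Finset.range n,
      c (k + 1) * prabhakarKernel γ ρ ((μ : ℂ) - (n : ℂ) + 1 + (k : ℂ)) ω (t - a) +
        prabhakarIntegral γ ρ (μ : ℂ) ω a h t := hsumc.add hIc
  rw [lhs, prabhakarIntegral_congr hP ht, prabhakarIntegral_add hρ hμ0 _ _ _ _ h1s hhc,
    prabhakarIntegral_sum hρ hμ0 _ _ _ _ _ _ (fun k _ => h1c (k + 1)),
    prabhakarIntegral_iterate_primitiveFrom hρ hμν γ ω a b hh _ ht,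
    iterate_primitiveFrom_eq_prabhakarIntegral hρ ω a b hIc n ht,
    iterate_primitiveFrom_eq_prabhakarIntegral hρ ω a b hsI n ht,
    prabhakarIntegral_add hρ hn1 _ _ _ _ hsumc hIc,
    prabhakarIntegral_sum hρ hn1 _ _ _ _ _ _ (fun k _ => hKc k)]
  congr 1
  refine Finset.sum_congr rfl fun k _ => ?_
  congr 1
  have hμ1 : 0 < ((μ : ℂ) + 1).re := by simp; linarith
  have hone : EqOn (prabhakarIntegral γ ρ (μ : ℂ) ω a fun _ => 1)
      (fun t => prabhakarKernel γ ρ ((μ : ℂ) + 1) ω (t - a)) (Icc a b) :=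
    fun s hs => prabhakarIntegral_one hρ hμ0 γ ω hs.1
  have hiter : ∀ j, EqOn ((primitiveFrom a)^[j] (prabhakarIntegral γ ρ (μ : ℂ) ω a fun _ => 1))
      ((primitiveFrom a)^[j] fun t => prabhakarKernel γ ρ ((μ : ℂ) + 1) ω (t - a)) (Icc a b) := by
    intro j
    induction j with
    | zero => exact hone
    | succ j ih =>
      rw [Function.iterate_succ_apply', Function.iterate_succ_apply']
      exact primitiveFrom_congr ih
  rw [prabhakarIntegral_iterate_primitiveFrom hρ hμν γ ω a b continuous_const _ ht,
    hiter _ ht, iterate_primitiveFrom_prabhakarKernel hρ hμ1 γ ω a b _ ht,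
    ← iterate_primitiveFrom_eq_prabhakarIntegral hρ ω a b (hKc k) n ht,
    iterate_primitiveFrom_prabhakarKernel hρ (hν0 k) γ ω a b _ ht]
  -- Both sides are the kernel of order `μ + k + 2`.
  have e : (μ : ℂ) + 1 + ((k + 1 : ℕ) : ℂ) =
      (μ : ℂ) - (n : ℂ) + 1 + (k : ℂ) + ((n + 1 : ℕ) : ℂ) := by
    push_cast
    ring
  rw [e]

/-! ### Derivatives and the conditions at the left end point -/

theorem hasDerivWithinAt_prabhakarKernel {ρ ν : ℂ} (hρ : 0 < ρ.re) (hν : ν = 1 ∨ 1 < ν.re)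
    (γ ω : ℂ) {a b t : ℝ} (ht : t ∈ Icc a b) :
    HasDerivWithinAt (fun s => prabhakarKernel γ ρ (ν + 1) ω (s - a))
      (prabhakarKernel γ ρ ν ω (t - a)) (Icc a b) t := by
  have hν' : 0 < ν.re := by
    rcases hν with rfl | hν
    · simp
    · linarith
  have hc : Continuous fun s => prabhakarKernel γ ρ ν ω (s - a) :=
    (continuous_prabhakarKernel hρ hν γ ω).comp (continuous_id.sub continuous_const)
  have hE := primitiveFrom_prabhakarKernel hρ hν' γ ω a b
  exact (hasDerivAt_primitiveFrom hc a t).hasDerivWithinAt.congr (fun s hs => (hE hs).symm)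
    (hE ht).symm

theorem hasDerivWithinAt_prabhakarIntegral {ρ ν : ℂ} (hρ : 0 < ρ.re) (hν : ν = 1 ∨ 1 < ν.re)
    (γ ω : ℂ) {a b t : ℝ} {h : ℝ → ℂ} (hh : Continuous h) (ht : t ∈ Icc a b) :
    HasDerivWithinAt (prabhakarIntegral γ ρ (ν + 1) ω a h)
      (prabhakarIntegral γ ρ ν ω a h t) (Icc a b) t := by
  have hν' : 0 < ν.re := by
    rcases hν with rfl | hν
    · simp
    · linarith
  have hE : EqOn (prabhakarIntegral γ ρ (ν + 1) ω a h)
      (primitiveFrom a (prabhakarIntegral γ ρ ν ω a h)) (Icc a b) := by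
    intro s hs
    rw [← prabhakarIntegral_zero_one ρ ω a, prabhakarIntegral_prabhakarIntegral hρ (Or.inl rfl) hν'
      _ _ _ (hh.intervalIntegrable a b) hs, zero_add, add_comm 1]
  exact (hasDerivAt_primitiveFrom (continuous_prabhakarIntegral hρ hν γ ω a hh)
    a t).hasDerivWithinAt.congr hE (hE ht)

theorem prabhakarIntegral_self (γ ρ ν ω : ℂ) (a : ℝ) (h : ℝ → ℂ) :
    prabhakarIntegral γ ρ ν ω a h a = 0 := by
  simp [prabhakarIntegral]

theorem prabhakarIntegral_neg (γ ρ ν ω : ℂ) (a t : ℝ) (h : ℝ → ℂ) :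
    prabhakarIntegral γ ρ ν ω a (fun s => -h s) t = -prabhakarIntegral γ ρ ν ω a h t := by
  simp [prabhakarIntegral]

/-- The difference quotient at `a` is `r^(ν-2) E(ω r^ρ)`. As `ν ≤ 2`, for `r ≤ 1` its norm is at
least that of `E(ω r^ρ)`, which tends to `1 / |Γ(ν)| ≠ 0`. -/
theorem not_hasDerivWithinAt_prabhakarKernel_zero {ρ : ℂ} (hρ : 0 < ρ.re) (γ ω : ℂ) {ν a b : ℝ}
    (hν : 1 < ν) (hν' : ν ≤ 2) (hab : a < b) :
    ¬ HasDerivWithinAt (fun s => prabhakarKernel γ ρ (ν : ℂ) ω (s - a)) 0 (Icc a b) a := by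
  intro hd
  have h0 : prabhakarKernel γ ρ (ν : ℂ) ω 0 = 0 :=
    prabhakarKernel_zero_right (by exact_mod_cast hν.ne') _ _ _
  have hs := (hasDerivWithinAt_iff_tendsto_slope' left_notMem_Ioc).1 (hd.mono Ioc_subset_Icc_self)
  rw [nhdsWithin_Ioc_eq_nhdsGT hab] at hs
  have hE : Tendsto (fun t : ℝ => mittagLeffler γ ρ (ν : ℂ) (ω * ((t - a : ℝ) : ℂ) ^ ρ))
      (𝓝[>] a) (𝓝 (Complex.Gamma (ν : ℂ))⁻¹) := by
    have hc := ((continuous_mittagLeffler_mul_ofReal_cpow hρ γ (ν : ℂ) ω).comp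
      (continuous_id.sub (continuous_const (y := a)))).tendsto a
    have hρ0 : ρ ≠ 0 := by rintro rfl; simp at hρ
    simp only [Function.comp, Pi.sub_apply, id, sub_self, Complex.ofReal_zero,
      Complex.zero_cpow hρ0, mul_zero, mittagLeffler_zero_right] at hc
    exact hc.mono_left nhdsWithin_le_nhds
  refine inv_ne_zero (Complex.Gamma_ne_zero_of_re_pos (s := (ν : ℂ))
      (by rw [Complex.ofReal_re]; linarith))
    (tendsto_nhds_unique hE (squeeze_zero_norm' ?_ (by simpa using hs.norm)))
  filter_upwards [Ioo_mem_nhdsGT (show a < a + 1 by linarith)] with t ht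
  have hr : 0 < t - a := by linarith [ht.1]
  have hr1 : t - a ≤ 1 := by linarith [ht.2]
  rw [slope_def_module, sub_self, h0, sub_zero, norm_smul, prabhakarKernel, norm_mul,
    Complex.norm_cpow_eq_rpow_re_of_pos hr, norm_inv, Real.norm_of_nonneg hr.le, ← mul_assoc]
  refine le_mul_of_one_le_left (norm_nonneg _) ?_
  have : ((ν : ℂ) - 1).re = ν - 1 := by simp
  rw [this, ← Real.rpow_neg_one, ← Real.rpow_add hr]
  exact Real.one_le_rpow_of_pos_of_le_one_of_nonpos hr hr1 (by linarith)

/-- A solution of the equation that vanishes to first order at `a` is a multiple of the kernel of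
order `μ` minus a Prabhakar integral of `q x`. -/
theorem exists_eq_mul_prabhakarKernel_sub_prabhakarIntegral {γ ρ ω : ℂ} (hρ : 0 < ρ.re)
    {μ a b : ℝ} (hμ : 2 < μ) (hμ' : μ ≤ 3) (hab : a < b) {x y h : ℝ → ℂ} (hy : Continuous y)
    (hxy : EqOn x y (Icc a b)) (hh : Continuous h)
    (hd : PrabhakarDifferentiableOn γ ρ (μ : ℂ) ω a b x)
    (hm : ∀ t ∈ Ioo a b, prabhakarDeriv γ ρ (μ : ℂ) ω a x t + h t = 0)
    (hxa : x a = 0) (hxd : HasDerivWithinAt x 0 (Icc a b) a) :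
    ∃ c : ℂ, ∀ t ∈ Icc a b,
      x t = c * prabhakarKernel γ ρ (μ : ℂ) ω (t - a) - prabhakarIntegral γ ρ (μ : ℂ) ω a h t := by
  have ha : a ∈ Icc a b := left_mem_Icc.2 hab.le
  have hcast : ((μ : ℂ) - 1) = ((μ - 1 : ℝ) : ℂ) := by push_cast; rfl
  have hμ1 : (μ : ℂ) - 1 = 1 ∨ 1 < ((μ : ℂ) - 1).re :=
    Or.inr (by rw [hcast, Complex.ofReal_re]; linarith)
  have hne : ((μ : ℂ) - 1) ≠ 1 := by
    rw [hcast]; norm_cast; linarith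
  have hne' : (μ : ℂ) ≠ 1 := by norm_cast; linarith
  obtain ⟨c₁, c₂, hx⟩ : ∃ c₁ c₂ : ℂ, ∀ t ∈ Icc a b,
      x t = c₁ * prabhakarKernel γ ρ ((μ : ℂ) - 1) ω (t - a) +
        c₂ * prabhakarKernel γ ρ (μ : ℂ) ω (t - a) -
          prabhakarIntegral γ ρ (μ : ℂ) ω a h t := by
    obtain ⟨c, hc⟩ := eq_sum_prabhakarKernel_add_prabhakarIntegral hρ (by linarith : 1 < μ) hab hy
      hxy hh.neg hd (fun t ht => eq_neg_of_add_eq_zero_left (hm t ht))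
    simp only [Pi.neg_def, prabhakarIntegral_neg] at hc
    -- For `μ = 3` the floor is `3` and kernels of orders `1, 2, 3` occur. At `a` only the first is
    -- nonzero, so `x a = 0` removes it.
    rcases hμ'.eq_or_lt with rfl | hμ3
    · have hfl : ⌊(3 : ℝ)⌋₊ = 3 := by norm_num
      simp only [hfl, Finset.sum_range_succ, Finset.sum_range_zero] at hc
      norm_num at hc hne hne' ⊢
      have h0 := hc a le_rfl hab.le
      have hρ0 : ρ ≠ 0 := by rintro rfl; simp at hρ
      have hK1 : prabhakarKernel γ ρ 1 ω 0 = 1 := by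
        simp [prabhakarKernel, Complex.zero_cpow hρ0, mittagLeffler_zero_right]
      rw [hxa, sub_self, prabhakarIntegral_self, prabhakarKernel_zero_right (ν := 2) (by norm_num),
        prabhakarKernel_zero_right (ν := 3) (by norm_num), hK1] at h0
      refine ⟨c 1, c 2, fun t h1 h2 => ?_⟩
      rw [hc t h1 h2, show c 0 = 0 by linear_combination -h0]
      ring
    · have hfl : ⌊μ⌋₊ = 2 := (Nat.floor_eq_iff (by linarith)).2 ⟨by norm_num; linarith, by
        norm_num; linarith⟩
      refine ⟨c 0, c 1, fun t ht => ?_⟩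
      rw [hc t ht, hfl]
      simp only [Finset.sum_range_succ, Finset.sum_range_zero, zero_add]
      have e0 : (μ : ℂ) - ((2 : ℕ) : ℂ) + 1 + ((0 : ℕ) : ℂ) = μ - 1 := by push_cast; ring
      have e1 : (μ : ℂ) - ((2 : ℕ) : ℂ) + 1 + ((1 : ℕ) : ℂ) = μ := by push_cast; ring
      rw [e0, e1]
      ring
  have hdK := hasDerivWithinAt_prabhakarKernel hρ hμ1 γ ω ha
  have hdI := hasDerivWithinAt_prabhakarIntegral hρ hμ1 γ ω hh ha
  rw [sub_add_cancel] at hdK hdI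
  rw [sub_self, prabhakarKernel_zero_right hne] at hdK
  rw [prabhakarIntegral_self] at hdI
  -- Otherwise `e_(μ-1)` would be a combination of functions with zero derivative at `a`.
  have hc₁ : c₁ = 0 := by
    by_contra hc
    refine not_hasDerivWithinAt_prabhakarKernel_zero hρ γ ω (ν := μ - 1) (by linarith)
      (by linarith) hab ?_
    have h1 := (((hxd.sub (hdK.const_mul c₂)).add hdI).const_mul c₁⁻¹)
    simp only [mul_zero, sub_zero, add_zero] at h1
    have hE : ∀ t ∈ Icc a b, prabhakarKernel γ ρ ((μ - 1 : ℝ) : ℂ) ω (t - a) = c₁⁻¹ *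
        (x t - c₂ * prabhakarKernel γ ρ (μ : ℂ) ω (t - a) +
          prabhakarIntegral γ ρ (μ : ℂ) ω a h t) := by
      intro t ht
      rw [← hcast, hx t ht]
      field_simp
      ring
    exact h1.congr hE (hE a ha)
  refine ⟨c₂, fun t ht => ?_⟩
  rw [hx t ht, hc₁]
  ring

/-! ### Green's function and the condition at the right end point -/

theorem integral_greenFunction {γ ρ ω : ℂ} (hρ : 0 < ρ.re) {μ a b t : ℝ} (hμ : 2 < μ)
    (ht : t ∈ Icc a b) {q : ℝ → ℝ} {x h : ℝ → ℂ} (hh : Continuous h)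
    (hqx : ∀ s ∈ Icc a b, (q s : ℂ) * x s = h s) :
    IntervalIntegrable (fun s => greenFunction γ ρ ω μ a b t s * (q s : ℂ) * x s) volume a b ∧
      ∫ s in a..b, greenFunction γ ρ ω μ a b t s * (q s : ℂ) * x s =
        prabhakarKernel γ ρ (μ : ℂ) ω (t - a) / prabhakarKernel γ ρ ((μ : ℂ) - 1) ω (b - a) *
          prabhakarIntegral γ ρ ((μ : ℂ) - 1) ω a h b - prabhakarIntegral γ ρ (μ : ℂ) ω a h t := by
  have hab : a ≤ b := ht.1.trans ht.2
  have hcast : ((μ : ℂ) - 1) = ((μ - 1 : ℝ) : ℂ) := by push_cast; rfl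
  have hK1 := continuous_prabhakarKernel hρ (ν := (μ : ℂ) - 1)
    (Or.inr (by rw [hcast, Complex.ofReal_re]; linarith)) γ ω
  have hK := continuous_prabhakarKernel hρ (ν := (μ : ℂ))
    (Or.inr (by rw [Complex.ofReal_re]; linarith)) γ ω
  set A := prabhakarKernel γ ρ (μ : ℂ) ω (t - a) / prabhakarKernel γ ρ ((μ : ℂ) - 1) ω (b - a)
  have h0 : prabhakarKernel γ ρ (μ : ℂ) ω 0 = 0 :=
    prabhakarKernel_zero_right (by norm_cast; linarith) _ _ _
  -- As `e_μ(0) = 0`, the cutoff `s ≤ t` is absorbed into `max (t - s) 0`, which makes the integrand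
  -- continuous.
  have hG : EqOn (fun s => greenFunction γ ρ ω μ a b t s * (q s : ℂ) * x s)
      (fun s => A * (prabhakarKernel γ ρ ((μ : ℂ) - 1) ω (b - s) * h s) -
        prabhakarKernel γ ρ (μ : ℂ) ω (max (t - s) 0) * h s) (uIcc a b) := by
    intro s hs
    rw [uIcc_of_le hab] at hs
    beta_reduce
    rw [mul_assoc, hqx s hs, greenFunction]
    split_ifs with hst
    · rw [max_eq_left (by linarith)]; ring
    · rw [max_eq_right (by linarith), h0]; ring
  have c1 : Continuous fun s => A * (prabhakarKernel γ ρ ((μ : ℂ) - 1) ω (b - s) * h s) := by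
    fun_prop
  have c2 : Continuous fun s => prabhakarKernel γ ρ (μ : ℂ) ω (max (t - s) 0) * h s := by
    fun_prop
  refine ⟨((c1.sub c2).intervalIntegrable a b).congr (fun s hs => (hG (uIoc_subset_uIcc hs)).symm),
    ?_⟩
  rw [intervalIntegral.integral_congr hG, intervalIntegral.integral_sub
    (c1.intervalIntegrable _ _) (c2.intervalIntegrable _ _), intervalIntegral.integral_const_mul,
    ← intervalIntegral.integral_add_adjacent_intervals (c2.intervalIntegrable a t)
      (c2.intervalIntegrable t b)]
  have z : ∫ s in t..b, prabhakarKernel γ ρ (μ : ℂ) ω (max (t - s) 0) * h s = 0 := by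
    rw [← intervalIntegral.integral_zero (a := t) (b := b) (μ := volume) (E := ℂ)]
    refine intervalIntegral.integral_congr fun s hs => ?_
    rw [uIcc_of_le ht.2] at hs
    rw [max_eq_right (by linarith [hs.1]), h0, zero_mul]
  have e : ∫ s in a..t, prabhakarKernel γ ρ (μ : ℂ) ω (max (t - s) 0) * h s =
      prabhakarIntegral γ ρ (μ : ℂ) ω a h t := by
    refine intervalIntegral.integral_congr fun s hs => ?_
    rw [uIcc_of_le ht.1] at hs
    rw [max_eq_left (by linarith [hs.2])]
  rw [z, e, add_zero]
  rfl

theorem theorem1 (γ ρ ω : ℂ) (hρ : 0 < ρ.re) (μ a b β ξ : ℝ) (hμ : 2 < μ) (hμ' : μ ≤ 3)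
    (haξ : a < ξ) (hξb : ξ < b) (q : ℝ → ℝ) (hq : ContinuousOn q (Icc a b))
    (hE : mittagLeffler γ ρ ((μ : ℂ) - 1) (ω * ((b - a : ℝ) : ℂ) ^ ρ) ≠ 0)
    (hΔ : prabhakarKernel γ ρ ((μ : ℂ) - 1) ω (b - a)
      - (β : ℂ) * prabhakarKernel γ ρ (μ : ℂ) ω (ξ - a) ≠ 0)
    (x : ℝ → ℂ) (hx : IsNonlocalSolution γ ρ ω μ a b β ξ q x) :
    ∀ t ∈ Icc a b,
      IntervalIntegrable (fun s => greenFunction γ ρ ω μ a b t s * (q s : ℂ) * x s) volume a b ∧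
      IntervalIntegrable (fun s => greenFunction γ ρ ω μ a b ξ s * (q s : ℂ) * x s) volume a b ∧
      x t = (∫ s in a..b, greenFunction γ ρ ω μ a b t s * (q s : ℂ) * x s)
        + (β : ℂ) * prabhakarKernel γ ρ (μ : ℂ) ω (t - a) /
            (prabhakarKernel γ ρ ((μ : ℂ) - 1) ω (b - a)
              - (β : ℂ) * prabhakarKernel γ ρ (μ : ℂ) ω (ξ - a))
          * ∫ s in a..b, greenFunction γ ρ ω μ a b ξ s * (q s : ℂ) * x s := by
  have hab : a < b := haξ.trans hξb
  have hb : b ∈ Icc a b := right_mem_Icc.2 hab.le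
  -- Constant extension beyond the end points supplies the global continuity used above; only values
  -- on `[a, b]` matter.
  set y : ℝ → ℂ := IccExtend hab.le ((Icc a b).domRestrict x) with hydef
  set p : ℝ → ℝ := IccExtend hab.le ((Icc a b).domRestrict q) with hpdef
  have hy : Continuous y := hx.continuousOn.domRestrict.Icc_extend'
  have hp : Continuous p := hq.domRestrict.Icc_extend'
  have hxy : EqOn x y (Icc a b) := fun t ht => by
    rw [hydef, IccExtend_of_mem hab.le _ ht, domRestrict_apply]
  have hqp : EqOn q p (Icc a b) := fun t ht => by
    rw [hpdef, IccExtend_of_mem hab.le _ ht, domRestrict_apply]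
  have hh : Continuous fun s => (p s : ℂ) * y s := by fun_prop
  have hqx : ∀ s ∈ Icc a b, (q s : ℂ) * x s = (p s : ℂ) * y s := fun s hs => by
    rw [hxy hs, hqp hs]
  set h : ℝ → ℂ := fun s => (p s : ℂ) * y s
  obtain ⟨c, hc⟩ := exists_eq_mul_prabhakarKernel_sub_prabhakarIntegral hρ hμ hμ' hab hy hxy hh
    hx.differentiableOn (fun t ht => by
      have heq : (q t : ℂ) * x t = h t := hqx t (Ioo_subset_Icc_self ht)
      rw [← heq]
      exact hx.equation t ht) hx.left_value hx.left_deriv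
  have hcast : ((μ : ℂ) - 1) = ((μ - 1 : ℝ) : ℂ) := by push_cast; rfl
  have hμ1 : (μ : ℂ) - 1 = 1 ∨ 1 < ((μ : ℂ) - 1).re :=
    Or.inr (by rw [hcast, Complex.ofReal_re]; linarith)
  have hdK := hasDerivWithinAt_prabhakarKernel hρ hμ1 γ ω hb
  have hdI := hasDerivWithinAt_prabhakarIntegral hρ hμ1 γ ω hh hb
  rw [sub_add_cancel] at hdK hdI
  -- Two expressions for `x'(b)`: `c B - S = β x(ξ)` in the notation below.
  have hbd := (uniqueDiffOn_Icc hab b hb).eq_deriv _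
    (((hdK.const_mul c).sub hdI).congr hc (hc b hb)) hx.right_deriv
  have hB : prabhakarKernel γ ρ ((μ : ℂ) - 1) ω (b - a) ≠ 0 := by
    refine mul_ne_zero ?_ hE
    have : ((b - a : ℝ) : ℂ) ≠ 0 := Complex.ofReal_ne_zero.2 (by linarith)
    exact fun h0 => this (Complex.cpow_eq_zero_iff _ _ |>.1 h0).1
  have hξ : ξ ∈ Icc a b := ⟨haξ.le, hξb.le⟩
  intro t ht
  obtain ⟨i1, e1⟩ := integral_greenFunction (γ := γ) (ω := ω) hρ hμ ht hh hqx
  obtain ⟨i2, e2⟩ := integral_greenFunction (γ := γ) (ω := ω) hρ hμ hξ hh hqx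
  refine ⟨i1, i2, ?_⟩
  rw [e1, e2, hc t ht]
  have hX := hc ξ hξ
  set B := prabhakarKernel γ ρ ((μ : ℂ) - 1) ω (b - a)
  set Eξ := prabhakarKernel γ ρ (μ : ℂ) ω (ξ - a)
  set S := prabhakarIntegral γ ρ ((μ : ℂ) - 1) ω a h b
  set Sξ := prabhakarIntegral γ ρ (μ : ℂ) ω a h ξ
  -- The left side is the Green integral at `ξ`. Dividing by `B - β Eξ` turns the nonlocal term into
  -- `β x(ξ) e_μ(t-a) / B`.
  have key : Eξ / B * S - Sξ = x ξ * (B - β * Eξ) / B := by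
    field_simp
    linear_combination (-Eξ) * hbd - B * hX
  have hcB : c = (β * x ξ + S) / B := by
    field_simp
    linear_combination hbd
  rw [key, hcB]
  field_simp
  ring
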